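/- For a bounded set $E\subset\mathbb{R}^d$ and $\delta>0$ let $N_\delta(E)$ be the least number of open balls of radius $\delta$ needed to cover $E$, and let $B(x,\delta)$ be the open Euclidean ball. For $F\subset\mathbb{R}^d$ and $\theta\in(0,1)$ define the Assouad spectrum $$\dim_{\mathrm{A}}^{\theta}F=\inf\Bigl\{\alpha:\exists C>0\ \forall\,0<\delta\le 1\ \forall x\in F,\ N_{\delta^{1/\theta}}(F\cap B(x,\delta))\le C\Bigl(\frac{\delta}{\delta^{1/\theta}}\Bigr)^{\alpha}\Bigr\},$$ the upper Assouad spectrum $$\overline{\dim}_{\mathrm{A}}^{\theta}F=\inf\Bigl\{\alpha:\exists C>0\ \forall\,0<\delta\le 1\ \forall\,0<\delta'\le\delta^{1/\theta}\ \forall x\in F,\ N_{\delta'}(F\cap B(x,\delta))\le C\Bigl(\frac{\delta}{\delta'}\Bigr)^{\alpha}\Bigr\},$$ and the quasi-Assouad dimension $\dim_{\mathrm{qA}}F=\lim_{\theta\to1^-}\overline{\dim}_{\mathrm{A}}^{\theta}F$. (i) There is a compact set $F\subset\mathbb{R}$ such that $\theta\mapsto\dim_{\mathrm{A}}^{\theta}F$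 is not Hölder in any neighbourhood of $1$: for every neighbourhood $U$ of $1$ there are no $C\ge 0$ and $r>0$ with $|\dim_{\mathrm{A}}^{\theta}F-\dim_{\mathrm{A}}^{\theta'}F|\le C|\theta-\theta'|^{r}$ for all $\theta,\theta'\in U\cap(0,1)$. (ii) There is no lower control on the rate at which the Assouad spectrum converges to the quasi-Assouad dimension: let $d\in\mathbb{N}$ and let $f\colon[0,1]\to[0,d]$ be an increasing (i.e. non-decreasing) function with $f(0)>0$ and $\lim_{\theta\to1^-}f(\theta)=f(1)$. Then there is a compact set $F\subset\mathbb{R}^d$ such that $\dim_{\mathrm{A}}^{\theta}F\le f(\theta)$ for all $\theta\in(0,1)$ and $\lim_{\theta\to1^-}\dim_{\mathrm{A}}^{\theta}F=f(1)=\dim_{\mathrm{qA}}F$. -/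

import Mathlib

open Set Filter Topology
open scoped NNReal ENNReal

/-- `N_δ(F)`: the least number of open balls of radius `δ` (with arbitrary centres in the
ambient space) needed to cover `F`; it is `⊤` if no finite family suffices. -/
noncomputable def coverNum {E : Type*} [PseudoMetricSpace E] (δ : ℝ) (F : Set E) : ℕ∞ :=
  ⨅ (t : Finset E) (_ : F ⊆ ⋃ y ∈ t, Metric.ball y δ), (t.card : ℕ∞)

/-- The Assouad spectrum of `F` at `θ ∈ (0, 1)`:
the infimum of all `α` for which there is `C > 0` such that
`N_{δ^{1/θ}}(F ∩ B(x, δ)) ≤ C (δ / δ^{1/θ})^α` for all `0 < δ ≤ 1` and all `x ∈ F`.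
For subsets of a finite-dimensional space the set of such `α` is nonempty (it contains the
dimension of the space), and it is bounded below by `0` if `F` is nonempty. -/
noncomputable def assouadSpectrum {E : Type*} [NormedAddCommGroup E] [NormedSpace ℝ E]
    [FiniteDimensional ℝ E] (θ : ℝ) (F : Set E) : ℝ :=
  sInf {α : ℝ | ∃ C : ℝ, 0 < C ∧ ∀ δ : ℝ, 0 < δ → δ ≤ 1 → ∀ x ∈ F,
    (coverNum (δ ^ (1 / θ)) (F ∩ Metric.ball x δ) : ℝ≥0∞) ≤
      ENNReal.ofReal (C * (δ / δ ^ (1 / θ)) ^ α)}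

/-- The upper Assouad spectrum of `F` at `θ ∈ (0, 1)`: as for the Assouad spectrum, but the
bound is required for all smaller scales `0 < ρ ≤ δ^{1/θ}`. -/
noncomputable def upperAssouadSpectrum {E : Type*} [NormedAddCommGroup E] [NormedSpace ℝ E]
    [FiniteDimensional ℝ E] (θ : ℝ) (F : Set E) : ℝ :=
  sInf {α : ℝ | ∃ C : ℝ, 0 < C ∧ ∀ δ : ℝ, 0 < δ → δ ≤ 1 →
    ∀ ρ : ℝ, 0 < ρ → ρ ≤ δ ^ (1 / θ) → ∀ x ∈ F,
    (coverNum ρ (F ∩ Metric.ball x δ) : ℝ≥0∞) ≤ ENNReal.ofReal (C * (δ / ρ) ^ α)}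

/-- The quasi-Assouad dimension of `F`: the limit of the upper Assouad spectrum as `θ → 1` from
the left. The limit exists, since the upper Assouad spectrum is increasing in `θ ∈ (0, 1)` and
bounded by the dimension of the space. -/
noncomputable def quasiAssouadDim {E : Type*} [NormedAddCommGroup E] [NormedSpace ℝ E]
    [FiniteDimensional ℝ E] (F : Set E) : ℝ :=
  limUnder (𝓝[<] (1 : ℝ)) (fun θ => upperAssouadSpectrum θ F)

/-! Part (ii). The set is a union of finite self-similar blocks shrinking to the origin. A block of
type `n` is a scaled copy of a `d`-fold product of a level-`k` digit set of ratio `ρ` with `2 ^ d =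
ρ ^ (-s n)`. It looks `s n`-dimensional from its diameter, about `δ`, down to `δ * ρ ^ k = δ ^ (1 +
c / (s n * (n + 1)))`, and is discrete below that. Here `c = f 0` and `s n = f (1 - 1 / (n + 1))`.

Upper bound: fix `θ` and let `r ≤ R ^ (1 / θ)`, so that `R / r ≥ r ^ (-(1 - θ))`. If `1 - 1 / (n +
1) ≤ θ`, then `s n ≤ f θ` by monotonicity, and the block has dimension at most `s n` at all scales
(`exists_coveredBy_spectrumBlock_inter_ball`). Otherwise `1 / (n + 1) ≤ 1 - θ`, and the block has so
few points that about `r ^ (-c / (n + 1)) ≤ (R / r) ^ c` balls cover all of it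
(`exists_coveredBy_spectrumBlock`), with `c ≤ f θ`. Only `O(log (1 / r))` blocks lie outside the
`r`-ball at the origin, a factor absorbed by any power of `R / r`. This bounds even the upper
spectrum by `f θ` (`upperAssouadSpectrum_spectrumSet_le`).

Lower bound: each `n` occurs at arbitrarily small scales, so for `θ` close to 1 (depending on `n`)
the spectrum is at least `s n` (`le_assouadSpectrum_spectrumSet`). As `s n → f 1`, both spectra are
squeezed to `f 1`.

Part (i) applies this with `d = 1` to an `f` that approaches `f 1` at logarithmic speed, slower than
any power of `1 - θ`. -/

/-! ### Digit sets: size, separation and splitting by levels. -/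

/-- The points `∑_{j < k} a_j ρ^j` with digits `a_j ∈ {0, 1}`. -/
noncomputable def digitSet (ρ : ℝ) : ℕ → Finset ℝ
  | 0 => {0}
  | k + 1 => digitSet ρ k ∪ (digitSet ρ k).image (fun y => y + ρ ^ k)

theorem mem_digitSet_succ {ρ y : ℝ} {k : ℕ} :
    y ∈ digitSet ρ (k + 1) ↔ y ∈ digitSet ρ k ∨ ∃ z ∈ digitSet ρ k, z + ρ ^ k = y := by
  simp only [digitSet, Finset.mem_union, Finset.mem_image]

theorem zero_mem_digitSet (ρ : ℝ) (k : ℕ) : (0 : ℝ) ∈ digitSet ρ k := by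
  induction k with
  | zero => simp [digitSet]
  | succ k ih => exact mem_digitSet_succ.2 (Or.inl ih)

theorem digitSet_mono (ρ : ℝ) : Monotone (digitSet ρ) :=
  monotone_nat_of_le_succ fun _ _ hy => mem_digitSet_succ.2 (Or.inl hy)

/-- The correction `-2 * ρ ^ k` is what makes the induction close: adding `ρ ^ k` leaves `2 - ρ ^
k`, and `ρ ^ (k + 1) ≤ ρ ^ k / 2`. -/
theorem digitSet_bounds {ρ : ℝ} (h0 : 0 < ρ) (h2 : ρ ≤ 1 / 2) (k : ℕ) :
    ∀ y ∈ digitSet ρ k, 0 ≤ y ∧ y ≤ 2 - 2 * ρ ^ k := by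
  induction k with
  | zero => simp [digitSet]
  | succ k ih =>
    intro y hy
    have hp : 0 < ρ ^ k := pow_pos h0 k
    have hs : ρ ^ (k + 1) ≤ ρ ^ k / 2 := by rw [pow_succ]; nlinarith
    rcases mem_digitSet_succ.1 hy with hy | ⟨z, hz, rfl⟩
    · have := ih y hy
      constructor <;> linarith
    · have := ih z hz
      constructor <;> linarith

theorem digitSet_mem_Icc {ρ : ℝ} (h0 : 0 < ρ) (h2 : ρ ≤ 1 / 2) {k : ℕ} {y : ℝ}
    (hy : y ∈ digitSet ρ k) : 0 ≤ y ∧ y ≤ 2 := by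
  have := digitSet_bounds h0 h2 k y hy
  have hp : 0 < ρ ^ k := pow_pos h0 k
  constructor <;> linarith

/-- A new point is an old one moved by `ρ ^ k`, half of the old separation, so a gap of at least `ρ
^ k ≥ 2 * ρ ^ (k + 1)` remains. -/
theorem digitSet_separated {ρ : ℝ} (h0 : 0 < ρ) (h2 : ρ ≤ 1 / 2) (k : ℕ) :
    ∀ y ∈ digitSet ρ k, ∀ z ∈ digitSet ρ k, y ≠ z → 2 * ρ ^ k ≤ |y - z| := by
  induction k with
  | zero => simp [digitSet]
  | succ k ih =>
    have hp : 0 < ρ ^ k := pow_pos h0 k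
    have hs : ρ ^ (k + 1) ≤ ρ ^ k / 2 := by rw [pow_succ]; nlinarith
    intro y hy z hz hne
    rcases mem_digitSet_succ.1 hy with hy' | ⟨y', hy', rfl⟩ <;>
      rcases mem_digitSet_succ.1 hz with hz' | ⟨z', hz', rfl⟩
    · have := ih y hy' z hz' hne
      linarith
    · rcases eq_or_ne y z' with rfl | h
      · rw [show y - (y + ρ ^ k) = -ρ ^ k by ring, abs_neg, abs_of_pos hp]
        linarith
      · rcases le_abs'.1 (ih y hy' z' hz' h) with h | h
        · exact le_abs'.2 (Or.inl (by linarith))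
        · exact le_abs'.2 (Or.inr (by linarith))
    · rcases eq_or_ne y' z with rfl | h
      · rw [show y' + ρ ^ k - y' = ρ ^ k by ring, abs_of_pos hp]
        linarith
      · rcases le_abs'.1 (ih y' hy' z hz' h) with h | h
        · exact le_abs'.2 (Or.inl (by linarith))
        · exact le_abs'.2 (Or.inr (by linarith))
    · have := ih y' hy' z' hz' (by rintro rfl; exact hne rfl)
      rw [show y' + ρ ^ k - (z' + ρ ^ k) = y' - z' by ring]
      linarith

theorem card_digitSet {ρ : ℝ} (h0 : 0 < ρ) (h2 : ρ ≤ 1 / 2) (k : ℕ) :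
    (digitSet ρ k).card = 2 ^ k := by
  induction k with
  | zero => simp [digitSet]
  | succ k ih =>
    have hp : 0 < ρ ^ k := pow_pos h0 k
    rw [digitSet, Finset.card_union_of_disjoint, Finset.card_image_of_injective _
      (add_left_injective _), ih, pow_succ]
    · ring
    · rw [Finset.disjoint_left]
      intro y hy hy'
      obtain ⟨z, hz, rfl⟩ := Finset.mem_image.1 hy'
      have := digitSet_separated h0 h2 k _ hy z hz (by linarith)
      rw [add_sub_cancel_left, abs_of_pos hp] at this
      linarith

theorem digitSet_split {ρ : ℝ} {u : ℕ} (j : ℕ) :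
    ∀ y ∈ digitSet ρ (u + j), ∃ q ∈ digitSet ρ u, ∃ w ∈ digitSet ρ j, y = q + ρ ^ u * w := by
  induction j with
  | zero => exact fun y hy => ⟨y, hy, 0, by simp [digitSet], by simp⟩
  | succ j ih =>
    intro y hy
    rw [← add_assoc] at hy
    rcases mem_digitSet_succ.1 hy with hy | ⟨z, hz, rfl⟩
    · obtain ⟨q, hq, w, hw, rfl⟩ := ih y hy
      exact ⟨q, hq, w, mem_digitSet_succ.2 (Or.inl hw), rfl⟩
    · obtain ⟨q, hq, w, hw, rfl⟩ := ih z hz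
      exact ⟨q, hq, w + ρ ^ j, mem_digitSet_succ.2 (Or.inr ⟨w, hw, rfl⟩), by rw [pow_add]; ring⟩

theorem card_le_of_separated {S : Finset ℝ} {a b h : ℝ} (hab : a ≤ b) (hh : 0 < h)
    (hS : ∀ y ∈ S, a ≤ y ∧ y ≤ b) (hsep : ∀ y ∈ S, ∀ z ∈ S, y ≠ z → h ≤ |y - z|) :
    (S.card : ℝ) ≤ (b - a) / h + 1 := by
  have hcard : S.card ≤ (Finset.range (⌊(b - a) / h⌋₊ + 1)).card := by
    refine Finset.card_le_card_of_injOn (fun y => ⌊(y - a) / h⌋₊) ?_ ?_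
    · intro y hy
      have := hS y hy
      simp only [Finset.coe_range, Set.mem_Iio, Nat.lt_succ_iff]
      exact Nat.floor_le_floor (by gcongr; linarith)
    · intro y hy z hz hyz
      by_contra hne
      have h1 := hsep y hy z hz hne
      have hy' : 0 ≤ (y - a) / h := div_nonneg (by linarith [hS y hy]) hh.le
      have hz' : 0 ≤ (z - a) / h := div_nonneg (by linarith [hS z hz]) hh.le
      have hyz : ⌊(y - a) / h⌋₊ = ⌊(z - a) / h⌋₊ := hyz
      have e1 := Nat.floor_le hy'
      have e2 := Nat.lt_floor_add_one ((y - a) / h)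
      have e3 := Nat.floor_le hz'
      have e4 := Nat.lt_floor_add_one ((z - a) / h)
      rw [hyz] at e1 e2
      have : |(y - a) / h - (z - a) / h| < 1 := by rw [abs_lt]; constructor <;> linarith
      rw [← sub_div, abs_div, abs_of_pos hh, div_lt_one hh] at this
      rw [show y - a - (z - a) = y - z by ring] at this
      linarith
  rw [Finset.card_range] at hcard
  have h2 : (S.card : ℝ) ≤ (⌊(b - a) / h⌋₊ : ℝ) + 1 := by exact_mod_cast hcard
  linarith [Nat.floor_le (div_nonneg (sub_nonneg.2 hab) hh.le)]

/-! ### Covering bounds for digit sets on the line. -/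

/-- `F` is covered by at most `M` open balls of radius `r`. -/
def CoveredBy {E : Type*} [PseudoMetricSpace E] (r : ℝ) (F : Set E) (M : ℝ) : Prop :=
  ∃ t : Finset E, F ⊆ ⋃ y ∈ t, Metric.ball y r ∧ (t.card : ℝ) ≤ M

theorem CoveredBy.mono {E : Type*} [PseudoMetricSpace E] {r M M' : ℝ} {F F' : Set E}
    (h : CoveredBy r F M) (hF : F' ⊆ F) (hM : M ≤ M') : CoveredBy r F' M' := by
  obtain ⟨t, ht, hc⟩ := h
  exact ⟨t, hF.trans ht, hc.trans hM⟩

theorem CoveredBy.union {E : Type*} [PseudoMetricSpace E] {r M M' : ℝ} {F F' : Set E}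
    (h : CoveredBy r F M) (h' : CoveredBy r F' M') : CoveredBy r (F ∪ F') (M + M') := by
  classical
  obtain ⟨t, ht, hc⟩ := h
  obtain ⟨t', ht', hc'⟩ := h'
  refine ⟨t ∪ t', ?_, ?_⟩
  · rw [Finset.set_biUnion_union]
    exact Set.union_subset_union ht ht'
  · have : ((t ∪ t').card : ℝ) ≤ t.card + t'.card := by exact_mod_cast Finset.card_union_le _ _
    linarith

theorem coveredBy_ball {E : Type*} [PseudoMetricSpace E] {r : ℝ} {x : E} :
    CoveredBy r (Metric.ball x r) 1 := ⟨{x}, by simp, by simp⟩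

theorem CoveredBy.biUnion_range {E : Type*} [PseudoMetricSpace E] {r M : ℝ} {B : ℕ → Set E}
    (h : ∀ k, CoveredBy r (B k) M) (L : ℕ) :
    CoveredBy r (⋃ k ∈ Finset.range L, B k) (L * M) := by
  induction L with
  | zero => exact ⟨∅, by simp, by simp⟩
  | succ L ih =>
    refine ((h L).union ih).mono ?_ ?_
    · rw [Finset.range_add_one, Finset.set_biUnion_insert]
    · push_cast
      linarith

theorem CoveredBy.coverNum_le {E : Type*} [PseudoMetricSpace E] {r M : ℝ} {F : Set E}
    (h : CoveredBy r F M) : (coverNum r F : ℝ≥0∞) ≤ ENNReal.ofReal M := by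
  obtain ⟨t, ht, hc⟩ := h
  have h1 : coverNum r F ≤ (t.card : ℕ∞) := iInf₂_le t ht
  calc (coverNum r F : ℝ≥0∞) ≤ ((t.card : ℕ∞) : ℝ≥0∞) := by exact_mod_cast h1
    _ = ENNReal.ofReal t.card := by simp
    _ ≤ _ := ENNReal.ofReal_le_ofReal hc

theorem le_coverNum {E : Type*} [PseudoMetricSpace E] {r : ℝ} {m : ℕ} {F : Set E}
    (h : ∀ t : Finset E, F ⊆ ⋃ y ∈ t, Metric.ball y r → m ≤ t.card) :
    ENNReal.ofReal m ≤ (coverNum r F : ℝ≥0∞) := by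
  have h1 : (m : ℕ∞) ≤ coverNum r F := le_iInf₂ fun t ht => by exact_mod_cast h t ht
  calc ENNReal.ofReal m = ((m : ℕ∞) : ℝ≥0∞) := by simp
    _ ≤ _ := by exact_mod_cast h1

/-- Write a point as `q + ρ ^ u * w + ρ ^ l * w'`. Boundedly many coarse parts `q` lie near the
ball, each has `2 ^ (l - u)` descendants at level `l`, and the tail `ρ ^ l * w'` is shorter than
`r`. When `u = 0` there is only one `q`; when `l = k` there is no tail. -/
theorem coveredBy_digitSet_inter_ball_of_levels {ρ : ℝ} (h0 : 0 < ρ) (h2 : ρ ≤ 1 / 2)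
    {u l k : ℕ} (hul : u ≤ l) (hlk : l ≤ k) {r R : ℝ} (hr : 0 < r) (hR : 0 < R)
    (hRu : u = 0 ∨ R * ρ ≤ ρ ^ u) (hrl : l = k ∨ 2 * ρ ^ l < r) (x : ℝ) :
    CoveredBy r ((digitSet ρ k : Set ℝ) ∩ Metric.ball x R) ((1 / ρ + 5) * 2 ^ (l - u)) := by
  classical
  have hpu : 0 < ρ ^ u := pow_pos h0 u
  have hpl : 0 < ρ ^ l := pow_pos h0 l
  have hplu : ρ ^ l ≤ ρ ^ u := pow_le_pow_of_le_one h0.le (by linarith) hul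
  -- Both `ρ ^ u * w` and `ρ ^ l * w'` are at most `2 * ρ ^ u`, hence the margin `4 * ρ ^ u`.
  set Q := (digitSet ρ u).filter (fun q => |q - x| ≤ R + 4 * ρ ^ u) with hQ
  have hQcard : (Q.card : ℝ) ≤ 1 / ρ + 5 := by
    have hρ : 0 < 1 / ρ := by positivity
    rcases hRu with rfl | hRu
    · have : Q.card ≤ 1 := (Finset.card_filter_le _ _).trans (by simp [digitSet])
      have : (Q.card : ℝ) ≤ 1 := by exact_mod_cast this
      linarith
    · have := card_le_of_separated (S := Q) (a := x - (R + 4 * ρ ^ u)) (b := x + (R + 4 * ρ ^ u))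
        (h := 2 * ρ ^ u) (by linarith) (by linarith)
        (fun y hy => by
          have := abs_le.1 (Finset.mem_filter.1 hy).2
          constructor <;> linarith)
        (fun y hy z hz => digitSet_separated h0 h2 u y (Finset.mem_filter.1 hy).1 z
          (Finset.mem_filter.1 hz).1)
      refine this.trans ?_
      have h3 : R / ρ ^ u ≤ 1 / ρ := by
        rw [div_le_div_iff₀ hpu h0]
        linarith
      have h4 : (x + (R + 4 * ρ ^ u) - (x - (R + 4 * ρ ^ u))) / (2 * ρ ^ u) = R / ρ ^ u + 4 := by
        field_simp
        ring
      rw [h4]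
      linarith
  refine ⟨(Q ×ˢ digitSet ρ (l - u)).image (fun p => p.1 + ρ ^ u * p.2), ?_, ?_⟩
  · rintro y ⟨hy, hyx⟩
    have hy' : y ∈ digitSet ρ (l + (k - l)) := by rwa [Nat.add_sub_cancel' hlk]
    obtain ⟨p, hp, w', hw', hyp⟩ := digitSet_split (k - l) y hy'
    have hp' : p ∈ digitSet ρ (u + (l - u)) := by rwa [Nat.add_sub_cancel' hul]
    obtain ⟨q, hq, w, hw, rfl⟩ := digitSet_split (l - u) p hp'
    have hwb := digitSet_mem_Icc h0 h2 hw
    have hwb' := digitSet_mem_Icc h0 h2 hw'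
    have e1 : 0 ≤ ρ ^ u * w := mul_nonneg hpu.le hwb.1
    have e2 : ρ ^ u * w ≤ ρ ^ u * 2 := by gcongr; exact hwb.2
    have e3 : 0 ≤ ρ ^ l * w' := mul_nonneg hpl.le hwb'.1
    have e4 : ρ ^ l * w' ≤ ρ ^ l * 2 := by gcongr; exact hwb'.2
    rw [Metric.mem_ball, Real.dist_eq, abs_lt] at hyx
    refine Set.mem_biUnion (x := q + ρ ^ u * w) ?_ ?_
    · refine Finset.mem_image.2 ⟨(q, w), Finset.mem_product.2 ⟨?_, hw⟩, rfl⟩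
      refine Finset.mem_filter.2 ⟨hq, ?_⟩
      rw [abs_le]
      constructor <;> linarith
    · rw [Metric.mem_ball, Real.dist_eq, hyp, add_sub_cancel_left, abs_of_nonneg e3]
      rcases hrl with rfl | hrl
      · simp only [Nat.sub_self, digitSet, Finset.mem_singleton] at hw'
        simpa [hw'] using hr
      · linarith
  · have hc : ((Q ×ˢ digitSet ρ (l - u)).image (fun p => p.1 + ρ ^ u * p.2)).card
        ≤ Q.card * 2 ^ (l - u) := by
      refine Finset.card_image_le.trans ?_
      rw [Finset.card_product, card_digitSet h0 h2]
    calc _ ≤ (Q.card : ℝ) * 2 ^ (l - u) := by exact_mod_cast hc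
      _ ≤ _ := by gcongr

theorem two_pow_eq_rpow {ρ σ : ℝ} (h0 : 0 < ρ) (hσ : ρ ^ σ = 1 / 2) (m : ℕ) :
    (2 : ℝ) ^ m = (1 / ρ ^ m) ^ σ := by
  rw [Real.div_rpow zero_le_one (by positivity), Real.one_rpow, ← Real.rpow_natCast ρ,
    ← Real.rpow_mul h0.le, mul_comm, Real.rpow_mul h0.le, hσ, Real.rpow_natCast]
  simp

theorem coveredBy_digitSet_inter_ball {ρ σ : ℝ} (h0 : 0 < ρ) (h2 : ρ ≤ 1 / 2) (hσ0 : 0 ≤ σ)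
    (hσ1 : σ ≤ 1) (hσ : ρ ^ σ = 1 / 2) (k : ℕ) {r R : ℝ} (hr : 0 < r) (hrR : r ≤ R) (x : ℝ) :
    CoveredBy r ((digitSet ρ k : Set ℝ) ∩ Metric.ball x R)
      (4 * (1 / ρ + 5) * (R / r) ^ σ) := by
  have hR : 0 < R := hr.trans_le hrR
  have h1 : ρ < 1 := by linarith
  have hC : 0 < 1 / ρ + 5 := by positivity
  have hone : 1 ≤ (R / r) ^ σ := Real.one_le_rpow ((one_le_div hr).2 hrR) hσ0
  have exu : ∃ u, ρ ^ u ≤ R := ((exists_pow_lt_of_lt_one hR h1)).imp fun _ h => h.le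
  have exl : ∃ l, 2 * ρ ^ l < r := by
    obtain ⟨l, hl⟩ := exists_pow_lt_of_lt_one (half_pos hr) h1
    exact ⟨l, by linarith⟩
  classical
  -- `u` and `l` are the first levels at which the digit scale drops to `R` and below `r / 2`. Both
  -- are capped at `k` below, since the digits stop there.
  set u := Nat.find exu with hu
  set l := Nat.find exl with hl
  have hu1 : ρ ^ u ≤ R := Nat.find_spec exu
  have hl1 : 2 * ρ ^ l < r := Nat.find_spec exl
  have hu2 : ∀ v, v < u → R < ρ ^ v := fun v hv => not_le.1 (Nat.find_min exu hv)
  have hl2 : ∀ v, v < l → r ≤ 2 * ρ ^ v := fun v hv => not_lt.1 (Nat.find_min exl hv)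
  have key := coveredBy_digitSet_inter_ball_of_levels h0 h2 (u := min u (min l k))
    (l := min l k) (k := k) (min_le_right _ _) (min_le_right _ _) hr hR ?_ ?_ x
  · refine key.mono subset_rfl ?_
    have h4 : (2 : ℝ) ^ (min l k - min u (min l k)) ≤ 4 * (R / r) ^ σ := by
      rcases le_or_gt (min l k) u with h | h
      · rw [min_eq_right h]
        simp only [Nat.sub_self, pow_zero]
        linarith
      · rw [min_eq_left h.le]
        obtain ⟨m, hm⟩ : ∃ m, l = u + m + 1 := Nat.exists_eq_add_of_lt (h.trans_le (min_le_left _ _))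
        have h5 : min l k - u ≤ m + 1 := by
          have := min_le_left l k
          omega
        have h6 := hl2 (u + m) (by omega)
        have hpm : 0 < ρ ^ m := pow_pos h0 m
        have h7 : 1 / ρ ^ m ≤ 2 * (R / r) := by
          rw [← mul_div_assoc, div_le_div_iff₀ hpm hr]
          rw [pow_add] at h6
          nlinarith
        calc (2 : ℝ) ^ (min l k - u) ≤ 2 ^ (m + 1) := pow_le_pow_right₀ one_le_two h5
          _ = 2 * (1 / ρ ^ m) ^ σ := by rw [pow_succ, two_pow_eq_rpow h0 hσ]; ring
          _ ≤ 2 * (2 * (R / r)) ^ σ := by gcongr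
          _ = 2 * (2 ^ σ * (R / r) ^ σ) := by rw [Real.mul_rpow (by norm_num) (by positivity)]
          _ ≤ 2 * (2 ^ (1 : ℝ) * (R / r) ^ σ) := by gcongr; norm_num
          _ = 4 * (R / r) ^ σ := by rw [Real.rpow_one]; ring
    calc (1 / ρ + 5) * 2 ^ (min l k - min u (min l k)) ≤ (1 / ρ + 5) * (4 * (R / r) ^ σ) := by
          gcongr
      _ = _ := by ring
  · rcases Nat.eq_zero_or_pos (min u (min l k)) with h | h
    · exact Or.inl h
    · right
      obtain ⟨v, hv⟩ := Nat.exists_eq_succ_of_ne_zero h.ne'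
      rw [hv, Nat.succ_eq_add_one, pow_succ]
      have := hu2 v (by have := min_le_left u (min l k); omega)
      gcongr
  · rcases le_total k l with h | h
    · exact Or.inl (min_eq_right h)
    · exact Or.inr (by rwa [min_eq_left h])

/-! ### Products of digit sets in Euclidean space. -/

/-- The `d`-dimensional power of the digit set, scaled by `δ`. -/
def digitBlock (d : ℕ) (δ ρ : ℝ) (k : ℕ) : Set (EuclideanSpace ℝ (Fin d)) :=
  {x | ∀ i, ∃ y ∈ digitSet ρ k, x i = δ * y}

/-- The crude factor `d + 1` in place of `√d` keeps the inequality strict, also for `d = 0`. -/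
theorem dist_lt_of_forall_dist_lt {d : ℕ} {x y : EuclideanSpace ℝ (Fin d)} {r : ℝ} (hr : 0 < r)
    (h : ∀ i, dist (x i) (y i) < r) : dist x y < (d + 1) * r := by
  rw [EuclideanSpace.dist_eq, Real.sqrt_lt' (by positivity)]
  calc ∑ i, dist (x i) (y i) ^ 2 ≤ ∑ _i : Fin d, r ^ 2 := by
        gcongr with i
        exact (h i).le
    _ = d * r ^ 2 := by simp
    _ < ((d + 1) * r) ^ 2 := by
        have : (0 : ℝ) ≤ d := d.cast_nonneg
        rw [mul_pow]
        gcongr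
        nlinarith

theorem dist_coord_le {d : ℕ} (x y : EuclideanSpace ℝ (Fin d)) (i : Fin d) :
    dist (x i) (y i) ≤ dist x y := by
  rw [EuclideanSpace.dist_eq]
  refine Real.le_sqrt_of_sq_le ?_
  exact Finset.single_le_sum (f := fun i => dist (x i) (y i) ^ 2) (fun _ _ => sq_nonneg _)
    (Finset.mem_univ i)

theorem CoveredBy.pi {d : ℕ} {K : Set ℝ} {r R M : ℝ} (hr : 0 < r)
    (x : EuclideanSpace ℝ (Fin d)) (h : ∀ i, CoveredBy r (K ∩ Metric.ball (x i) R) M) :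
    CoveredBy ((d + 1) * r) ({z : EuclideanSpace ℝ (Fin d) | ∀ i, z i ∈ K} ∩ Metric.ball x R)
      (M ^ d) := by
  classical
  choose t ht hc using h
  refine ⟨(Fintype.piFinset t).image (WithLp.toLp 2), ?_, ?_⟩
  · rintro z ⟨hz, hzx⟩
    have hi : ∀ i, ∃ y ∈ t i, dist (z i) y < r := fun i => by
      have := ht i ⟨hz i, (dist_coord_le z x i).trans_lt hzx⟩
      simpa using this
    choose y hy hzy using hi
    refine Set.mem_biUnion (x := WithLp.toLp 2 y) ?_ ?_
    · exact Finset.mem_image_of_mem _ (Fintype.mem_piFinset.2 hy)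
    · exact dist_lt_of_forall_dist_lt hr hzy
  · calc (((Fintype.piFinset t).image (WithLp.toLp 2)).card : ℝ)
          ≤ (Fintype.piFinset t).card := by exact_mod_cast Finset.card_image_le
      _ = ∏ i, ((t i).card : ℝ) := by rw [Fintype.card_piFinset]; push_cast; rfl
      _ ≤ ∏ _i : Fin d, M := Finset.prod_le_prod (fun _ _ => by positivity) fun i _ => hc i
      _ = M ^ d := by simp

theorem CoveredBy.const_mul {K : Set ℝ} {r R M δ c : ℝ} (hδ : 0 < δ)
    (h : CoveredBy (r / δ) (K ∩ Metric.ball (c / δ) (R / δ)) M) :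
    CoveredBy r ({z | ∃ y ∈ K, z = δ * y} ∩ Metric.ball c R) M := by
  classical
  have hd : ∀ a b : ℝ, dist (δ * a) b = δ * dist a (b / δ) := fun a b => by
    rw [Real.dist_eq, Real.dist_eq, ← abs_of_pos hδ, ← abs_mul, abs_of_pos hδ, mul_sub,
      mul_div_cancel₀ _ hδ.ne']
  obtain ⟨t, ht, hc⟩ := h
  refine ⟨t.image (δ * ·), ?_, le_trans (by exact_mod_cast Finset.card_image_le) hc⟩
  rintro z ⟨⟨y, hy, rfl⟩, hyc⟩
  have hyc' : y ∈ Metric.ball (c / δ) (R / δ) := by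
    rw [Metric.mem_ball, hd] at hyc
    rwa [Metric.mem_ball, lt_div_iff₀' hδ]
  obtain ⟨w, hw, hyw⟩ := Set.mem_iUnion₂.1 (ht ⟨hy, hyc'⟩)
  refine Set.mem_biUnion (x := δ * w) (Finset.mem_image_of_mem _ hw) ?_
  rw [Metric.mem_ball, hd, mul_div_cancel_left₀ _ hδ.ne', ← lt_div_iff₀' hδ]
  exact hyw

theorem coveredBy_digitBlock_inter_ball {d : ℕ} {δ ρ σ : ℝ} (hδ : 0 < δ) (h0 : 0 < ρ)
    (h2 : ρ ≤ 1 / 2) (hσ0 : 0 ≤ σ) (hσ1 : σ ≤ 1) (hσ : ρ ^ σ = 1 / 2) (k : ℕ) {r R : ℝ}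
    (hr : 0 < r) (hrR : r ≤ R) (x : EuclideanSpace ℝ (Fin d)) :
    CoveredBy r (digitBlock d δ ρ k ∩ Metric.ball x R)
      ((4 * (1 / ρ + 5) * (d + 1)) ^ d * (R / r) ^ (d * σ)) := by
  have hd : (0 : ℝ) < d + 1 := by positivity
  have hd1 : (1 : ℝ) ≤ d + 1 := by linarith [d.cast_nonneg (α := ℝ)]
  have hR : 0 < R := hr.trans_le hrR
  have hr' : r / (d + 1) ≤ R := (div_le_self hr.le hd1).trans hrR
  have key := CoveredBy.pi (r := r / (d + 1)) (K := {z | ∃ y ∈ (digitSet ρ k : Set ℝ), z = δ * y})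
    (R := R) (by positivity) x fun i => CoveredBy.const_mul hδ
      (coveredBy_digitSet_inter_ball h0 h2 hσ0 hσ1 hσ k (r := r / (d + 1) / δ) (R := R / δ)
        (by positivity) (by gcongr) (x i / δ))
  rw [mul_div_cancel₀ _ hd.ne'] at key
  refine key.mono subset_rfl ?_
  have e : R / δ / (r / (d + 1) / δ) = (R / r) * (d + 1) := by field_simp
  rw [e, Real.mul_rpow (by positivity) hd.le, mul_comm (d : ℝ) σ, Real.rpow_mul (by positivity),
    Real.rpow_natCast, ← mul_pow]
  have h3 : ((d : ℝ) + 1) ^ σ ≤ d + 1 := by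
    calc ((d : ℝ) + 1) ^ σ ≤ ((d : ℝ) + 1) ^ (1 : ℝ) := by gcongr
      _ = d + 1 := Real.rpow_one _
  have h4 : 0 ≤ (R / r) ^ σ := by positivity
  calc _ ≤ (4 * (1 / ρ + 5) * ((R / r) ^ σ * (d + 1))) ^ d := by gcongr
    _ = _ := by ring

theorem digitBlock_eq_image {d : ℕ} {δ ρ : ℝ} {k : ℕ} :
    digitBlock d δ ρ k = (fun a => WithLp.toLp 2 fun i => δ * a i) ''
      (Fintype.piFinset fun _ : Fin d => digitSet ρ k : Set (Fin d → ℝ)) := by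
  ext x
  constructor
  · intro hx
    choose y hy hxy using hx
    refine ⟨y, by simpa using hy, ?_⟩
    ext i
    exact (hxy i).symm
  · rintro ⟨a, ha, rfl⟩ i
    exact ⟨a i, by simpa using Fintype.mem_piFinset.1 ha i, rfl⟩

theorem digitBlock_finite (d : ℕ) (δ ρ : ℝ) (k : ℕ) : (digitBlock d δ ρ k).Finite := by
  rw [digitBlock_eq_image]
  exact (Finset.finite_toSet _).image _

theorem coveredBy_digitBlock {d : ℕ} {δ ρ : ℝ} (h0 : 0 < ρ) (h2 : ρ ≤ 1 / 2) (k : ℕ) {r : ℝ}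
    (hr : 0 < r) : CoveredBy r (digitBlock d δ ρ k) (2 ^ (d * k)) := by
  classical
  refine ⟨(Fintype.piFinset fun _ : Fin d => digitSet ρ k).image
    (fun a => WithLp.toLp 2 fun i => δ * a i), ?_, ?_⟩
  · rw [digitBlock_eq_image, ← Finset.coe_image]
    exact fun y hy => Set.mem_biUnion hy (Metric.mem_ball_self hr)
  · have : ((Fintype.piFinset fun _ : Fin d => digitSet ρ k).image
        (fun a => (WithLp.toLp 2 fun i => δ * a i : EuclideanSpace ℝ (Fin d)))).card
          ≤ 2 ^ (d * k) := by
      refine Finset.card_image_le.trans ?_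
      rw [Fintype.card_piFinset]
      simp [card_digitSet h0 h2, ← pow_mul, mul_comm]
    exact_mod_cast this

theorem zero_mem_digitBlock (d : ℕ) (δ ρ : ℝ) (k : ℕ) : 0 ∈ digitBlock d δ ρ k :=
  fun _ => ⟨0, zero_mem_digitSet ρ k, by simp⟩

theorem digitBlock_subset_ball {d : ℕ} {δ ρ r : ℝ} (hδ : 0 < δ) (h0 : 0 < ρ) (h2 : ρ ≤ 1 / 2)
    (k : ℕ) (hr : 3 * (d + 1) * δ ≤ r) : digitBlock d δ ρ k ⊆ Metric.ball 0 r := by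
  intro x hx
  refine (dist_lt_of_forall_dist_lt (r := 3 * δ) (by positivity) fun i => ?_).trans_le
    (by linarith)
  obtain ⟨y, hy, hxy⟩ := hx i
  have := digitSet_mem_Icc h0 h2 hy
  rw [hxy, PiLp.zero_apply, dist_zero_right, Real.norm_eq_abs, abs_of_nonneg (by nlinarith)]
  nlinarith

/-- Distinct level-`l` points differ by at least `2 * δ * ρ ^ l ≥ 2 * r` in some coordinate, so no
open `r`-ball contains two of them. -/
theorem two_pow_le_card_of_digitBlock_subset {d : ℕ} {δ ρ r : ℝ} (hδ : 0 < δ) (h0 : 0 < ρ)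
    (h2 : ρ ≤ 1 / 2) {k l : ℕ} (hlk : l ≤ k) (hr : r ≤ δ * ρ ^ l)
    (t : Finset (EuclideanSpace ℝ (Fin d)))
    (ht : digitBlock d δ ρ k ⊆ ⋃ y ∈ t, Metric.ball y r) : 2 ^ (d * l) ≤ t.card := by
  classical
  set P := Fintype.piFinset fun _ : Fin d => digitSet ρ l with hP
  let g : (Fin d → ℝ) → EuclideanSpace ℝ (Fin d) := fun a => WithLp.toLp 2 fun i => δ * a i
  have hcard : P.card = 2 ^ (d * l) := by
    rw [Fintype.card_piFinset]
    simp [card_digitSet h0 h2, ← pow_mul, mul_comm]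
  have hex : ∀ a ∈ P, ∃ y ∈ t, dist (g a) y < r := fun a ha => by
    have : g a ∈ digitBlock d δ ρ k := fun i =>
      ⟨a i, digitSet_mono ρ hlk (Fintype.mem_piFinset.1 ha i), rfl⟩
    simpa using ht this
  choose! c hc hdc using hex
  rw [← hcard]
  refine Finset.card_le_card_of_injOn c hc fun a ha b hb hab => ?_
  funext i
  by_contra hne
  have h3 := digitSet_separated h0 h2 l _ (Fintype.mem_piFinset.1 ha i) _
    (Fintype.mem_piFinset.1 hb i) hne
  have h4 := dist_coord_le (g a) (g b) i
  have h5 : dist (g a i) (g b i) = δ * |a i - b i| := by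
    change |δ * a i - δ * b i| = _
    rw [← mul_sub, abs_mul, abs_of_pos hδ]
  have h6 : dist (g a) (g b) < r + r := by
    refine (dist_triangle_right _ _ (c a)).trans_lt (add_lt_add (hdc a ha) ?_)
    rw [hab]
    exact hdc b hb
  nlinarith

/-! ### The blocks and their union. -/

/-- The scale of the `k`-th block, chosen so that
`2 ^ (d * k) = blockScale d c k ^ (-(c / (n + 1)))` for `n = (Nat.unpair k).1`. -/
noncomputable def blockScale (d : ℕ) (c : ℝ) (k : ℕ) : ℝ :=
  2 ^ (-(d * k * ((Nat.unpair k).1 + 1) / c))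

/-- The contraction ratio `ρ` with `2 ^ d * ρ ^ s n = 1` for `n = (Nat.unpair k).1`. -/
noncomputable def blockRatio (d : ℕ) (s : ℕ → ℝ) (k : ℕ) : ℝ :=
  2 ^ (-(d / s (Nat.unpair k).1))

/-- The `k`-th block: with `n = (Nat.unpair k).1`, it has `2 ^ (d * k)` points and is
`s n`-dimensional between its diameter `δ ≍ blockScale d c k` and `δ ^ (1 + c / (s n * (n + 1)))`. -/
noncomputable def spectrumBlock (d : ℕ) (c : ℝ) (s : ℕ → ℝ) (k : ℕ) :
    Set (EuclideanSpace ℝ (Fin d)) :=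
  digitBlock d (blockScale d c k) (blockRatio d s k) k

/-- The union of all blocks; each `n` occurs at infinitely many scales. -/
noncomputable def spectrumSet (d : ℕ) (c : ℝ) (s : ℕ → ℝ) : Set (EuclideanSpace ℝ (Fin d)) :=
  ⋃ k, spectrumBlock d c s k

theorem blockScale_pos (d : ℕ) (c : ℝ) (k : ℕ) : 0 < blockScale d c k :=
  Real.rpow_pos_of_pos two_pos _

theorem blockRatio_pos (d : ℕ) (s : ℕ → ℝ) (k : ℕ) : 0 < blockRatio d s k :=
  Real.rpow_pos_of_pos two_pos _

theorem two_rpow_neg_one : (2 : ℝ) ^ (-1 : ℝ) = 1 / 2 := by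
  rw [Real.rpow_neg_one]
  norm_num

theorem blockRatio_le {d : ℕ} {s : ℕ → ℝ} (h0 : ∀ n, 0 < s n) (hd : ∀ n, s n ≤ d) (k : ℕ) :
    blockRatio d s k ≤ 1 / 2 := by
  rw [← two_rpow_neg_one]
  refine Real.rpow_le_rpow_of_exponent_le one_le_two (neg_le_neg ?_)
  rw [one_le_div (h0 _)]
  exact hd _

theorem blockRatio_rpow {d : ℕ} {s : ℕ → ℝ} (h0 : ∀ n, 0 < s n) (hd : ∀ n, s n ≤ d) (k : ℕ) :
    blockRatio d s k ^ (s (Nat.unpair k).1 / d) = 1 / 2 := by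
  have h1 := h0 (Nat.unpair k).1
  have h2 := h1.trans_le (hd _)
  rw [blockRatio, ← Real.rpow_mul two_pos.le, ← two_rpow_neg_one]
  congr 1
  field_simp

/-- This bound, uniform in `k`, makes the covering constants independent of the block. -/
theorem le_blockRatio {d : ℕ} {c : ℝ} {s : ℕ → ℝ} (hc : 0 < c) (hcs : ∀ n, c ≤ s n) (k : ℕ) :
    (2 : ℝ) ^ (-(d / c)) ≤ blockRatio d s k := by
  refine Real.rpow_le_rpow_of_exponent_le one_le_two (neg_le_neg ?_)
  gcongr
  exact hcs _

theorem blockScale_le {d : ℕ} {c : ℝ} (hc : 0 < c) (hcd : c ≤ d) (k : ℕ) :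
    blockScale d c k ≤ (1 / 2) ^ k := by
  rw [← two_rpow_neg_one, ← Real.rpow_natCast, ← Real.rpow_mul two_pos.le]
  refine Real.rpow_le_rpow_of_exponent_le one_le_two ?_
  rw [neg_one_mul]
  refine neg_le_neg ?_
  rw [le_div_iff₀ hc]
  have h1 : (0 : ℝ) ≤ k := k.cast_nonneg
  have h2 : (0 : ℝ) ≤ (Nat.unpair k).1 := Nat.cast_nonneg _
  have h3 : 0 ≤ (d : ℝ) * k * (Nat.unpair k).1 := by positivity
  nlinarith

theorem two_pow_eq_blockScale_rpow {d : ℕ} {c : ℝ} (hc : 0 < c) (k : ℕ) :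
    (2 : ℝ) ^ (d * k) = blockScale d c k ^ (-(c / ((Nat.unpair k).1 + 1))) := by
  have h2 : (0 : ℝ) < (Nat.unpair k).1 + 1 := by positivity
  rw [blockScale, ← Real.rpow_mul two_pos.le, ← Real.rpow_natCast]
  congr 1
  push_cast
  field_simp

theorem blockRatio_pow_eq {d : ℕ} {c : ℝ} {s : ℕ → ℝ} (hc : 0 < c) (h0 : ∀ n, 0 < s n) (k : ℕ) :
    blockRatio d s k ^ k
      = blockScale d c k ^ (c / (s (Nat.unpair k).1 * ((Nat.unpair k).1 + 1))) := by
  have h1 := h0 (Nat.unpair k).1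
  have h2 : (0 : ℝ) < (Nat.unpair k).1 + 1 := by positivity
  rw [blockScale, blockRatio, ← Real.rpow_natCast, ← Real.rpow_mul two_pos.le,
    ← Real.rpow_mul two_pos.le]
  congr 1
  field_simp

/-! ### Upper covering bounds for the union. -/

section
variable {d : ℕ} {c : ℝ} {s : ℕ → ℝ}

theorem exists_coveredBy_spectrumBlock_inter_ball (hc : 0 < c) (hcs : ∀ n, c ≤ s n)
    (hsd : ∀ n, s n ≤ d) :
    ∃ C : ℝ, 1 ≤ C ∧ ∀ k, ∀ r R : ℝ, 0 < r → r ≤ R → ∀ x,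
      CoveredBy r (spectrumBlock d c s k ∩ Metric.ball x R)
        (C * (R / r) ^ s (Nat.unpair k).1) := by
  have h0 : ∀ n, 0 < s n := fun n => hc.trans_le (hcs n)
  have hd : (0 : ℝ) < d := (h0 0).trans_le (hsd 0)
  set ρ₀ : ℝ := 2 ^ (-(d / c)) with hρ₀
  have hρ₀pos : 0 < ρ₀ := Real.rpow_pos_of_pos two_pos _
  refine ⟨(4 * (1 / ρ₀ + 5) * (d + 1)) ^ d, ?_, ?_⟩
  · refine one_le_pow₀ ?_
    have : 0 < 1 / ρ₀ := by positivity
    nlinarith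
  · intro k r R hr hrR x
    have key := coveredBy_digitBlock_inter_ball (d := d) (blockScale_pos d c k)
      (blockRatio_pos d s k) (blockRatio_le h0 hsd k)
      (div_nonneg (h0 (Nat.unpair k).1).le hd.le) ((div_le_one hd).2 (hsd _))
      (blockRatio_rpow h0 hsd k) k hr hrR x
    rw [mul_div_cancel₀ _ hd.ne'] at key
    refine key.mono subset_rfl ?_
    have h1 := blockRatio_pos d s k
    have h2 : 0 ≤ (R / r) ^ s (Nat.unpair k).1 :=
      Real.rpow_nonneg (div_nonneg (hr.le.trans hrR) hr.le) _
    gcongr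
    exact le_blockRatio hc hcs k

/-- If `r` exceeds the diameter scale, one ball suffices. Otherwise the points are simply counted:
there are `δ ^ (-(c / (n + 1)))` of them, and `δ ≥ r / A`. -/
theorem exists_coveredBy_spectrumBlock (hc : 0 < c) (hcs : ∀ n, c ≤ s n) (hsd : ∀ n, s n ≤ d) :
    ∃ C : ℝ, 1 ≤ C ∧ ∀ k, ∀ r : ℝ, 0 < r → r ≤ 1 →
      CoveredBy r (spectrumBlock d c s k) (C * r ^ (-(c / ((Nat.unpair k).1 + 1)))) := by
  have h0 : ∀ n, 0 < s n := fun n => hc.trans_le (hcs n)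
  have hA : (1 : ℝ) ≤ 3 * (d + 1) := by
    have : (0 : ℝ) ≤ d := d.cast_nonneg
    linarith
  set A : ℝ := 3 * (d + 1)
  have hA0 : 0 < A := by linarith
  refine ⟨A ^ c, Real.one_le_rpow hA hc.le, fun k r hr hr1 => ?_⟩
  set e := c / ((Nat.unpair k).1 + 1 : ℝ)
  have he0 : 0 ≤ e := by positivity
  have hec : e ≤ c := div_le_self hc.le (by simp)
  rcases le_or_gt (A * blockScale d c k) r with h | h
  · refine (coveredBy_ball.mono (digitBlock_subset_ball (blockScale_pos d c k)
      (blockRatio_pos d s k) (blockRatio_le h0 hsd k) k h) ?_)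
    exact one_le_mul_of_one_le_of_one_le (Real.one_le_rpow hA hc.le)
      (Real.one_le_rpow_of_pos_of_le_one_of_nonpos hr hr1 (by linarith))
  · refine (coveredBy_digitBlock (blockRatio_pos d s k) (blockRatio_le h0 hsd k) k hr).mono
      subset_rfl ?_
    rw [two_pow_eq_blockScale_rpow hc]
    have h1 : r / A ≤ blockScale d c k := by
      rw [div_le_iff₀ hA0]
      linarith
    calc blockScale d c k ^ (-e) ≤ (r / A) ^ (-e) :=
          Real.rpow_le_rpow_of_nonpos (by positivity) h1 (by linarith)
      _ = A ^ e * r ^ (-e) := by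
          rw [Real.div_rpow hr.le hA0.le, Real.rpow_neg hA0.le, div_inv_eq_mul, mul_comm]
      _ ≤ A ^ c * r ^ (-e) := by
          gcongr

theorem exists_nat_add_one_le_mul_pow {b : ℝ} (hb : 1 < b) :
    ∃ C : ℝ, 0 < C ∧ ∀ n : ℕ, (n + 1 : ℝ) ≤ C * b ^ n := by
  have hb' : 0 < b - 1 := by linarith
  refine ⟨1 / (b - 1) + 1, by positivity, fun n => ?_⟩
  have h1 := one_add_mul_le_pow (show (-2 : ℝ) ≤ b - 1 by linarith) n
  rw [add_sub_cancel] at h1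
  have h2 : (n : ℝ) ≤ 1 / (b - 1) * b ^ n := by
    rw [one_div, ← div_eq_inv_mul, le_div_iff₀ hb']
    linarith
  have h3 : (1 : ℝ) ≤ b ^ n := one_le_pow₀ hb.le
  linarith

/-- Since block `k` has scale at most `2 ^ (-k)`, all but `O(log (1 / r))` blocks lie in a single
`r`-ball at the origin; the logarithm is bounded by a multiple of `r ^ (-ε)`. -/
theorem exists_coveredBy_spectrumSet_inter_ball (hc : 0 < c) (hcs : ∀ n, c ≤ s n)
    (hsd : ∀ n, s n ≤ d) {ε : ℝ} (hε : 0 < ε) :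
    ∃ C : ℝ, 0 < C ∧ ∀ r : ℝ, 0 < r → r ≤ 1 → ∀ x R M, 1 ≤ M →
      (∀ k, CoveredBy r (spectrumBlock d c s k ∩ Metric.ball x R) M) →
        CoveredBy r (spectrumSet d c s ∩ Metric.ball x R) (C * r ^ (-ε) * M) := by
  have h0 : ∀ n, 0 < s n := fun n => hc.trans_le (hcs n)
  have hA : (1 : ℝ) ≤ 3 * (d + 1) := by
    have : (0 : ℝ) ≤ d := d.cast_nonneg
    linarith
  set A : ℝ := 3 * (d + 1)
  have hA0 : 0 < A := by linarith
  obtain ⟨C, hC, hCn⟩ := exists_nat_add_one_le_mul_pow (Real.one_lt_rpow one_lt_two hε)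
  refine ⟨2 * C * A ^ ε, by positivity, fun r hr hr1 x R M hM hcov => ?_⟩
  obtain ⟨n, hn1, hn2⟩ := exists_nat_pow_near_of_lt_one (x := r / A) (y := 1 / 2) (by positivity)
    ((div_le_one hA0).2 (hr1.trans hA)) (by norm_num) (by norm_num)
  have hsmall : ∀ k, n + 1 ≤ k → spectrumBlock d c s k ⊆ Metric.ball 0 r := by
    intro k hk
    refine digitBlock_subset_ball (blockScale_pos d c k) (blockRatio_pos d s k)
      (blockRatio_le h0 hsd k) k ?_
    have h1 : blockScale d c k ≤ (1 / 2) ^ (n + 1) :=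
      (blockScale_le hc ((hcs 0).trans (hsd 0)) k).trans
        (pow_le_pow_of_le_one (by norm_num) (by norm_num) hk)
    have h2 := h1.trans hn1.le
    rwa [le_div_iff₀' hA0] at h2
  refine ((CoveredBy.biUnion_range hcov (n + 1)).union (coveredBy_ball (x := 0))).mono ?_ ?_
  · rintro y ⟨hy, hyx⟩
    obtain ⟨k, hk⟩ := Set.mem_iUnion.1 hy
    rcases lt_or_ge k (n + 1) with h | h
    · exact Or.inl (Set.mem_biUnion (by simpa using h) ⟨hk, hyx⟩)
    · exact Or.inr (hsmall k h hk)
  · have h3 : ((2 : ℝ) ^ ε) ^ n ≤ A ^ ε * r ^ (-ε) := by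
      have h4 : (2 : ℝ) ^ n ≤ A / r := by
        rw [one_div, inv_pow, div_le_iff₀ hA0] at hn2
        rw [le_div_iff₀ hr]
        have : (0 : ℝ) < 2 ^ n := by positivity
        calc (2 : ℝ) ^ n * r ≤ 2 ^ n * ((2 ^ n)⁻¹ * A) := by gcongr
          _ = A := by field_simp
      calc ((2 : ℝ) ^ ε) ^ n = (2 ^ n) ^ ε := by
            rw [← Real.rpow_natCast, ← Real.rpow_natCast, ← Real.rpow_mul two_pos.le,
              ← Real.rpow_mul two_pos.le, mul_comm]
        _ ≤ (A / r) ^ ε := by gcongr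
        _ = _ := by rw [Real.div_rpow hA0.le hr.le, Real.rpow_neg hr.le]; rfl
    have hn0 : (0 : ℝ) ≤ n := n.cast_nonneg
    calc ((n + 1 : ℕ) : ℝ) * M + 1 ≤ 2 * (n + 1) * M := by
          push_cast
          nlinarith
      _ ≤ 2 * (C * (A ^ ε * r ^ (-ε))) * M := by
          gcongr
          exact (hCn n).trans (by gcongr)
      _ = _ := by ring

theorem rpow_le_div_of_le_rpow {θ r R : ℝ} (hθ : 0 < θ) (hr : 0 < r) (hR : 0 < R)
    (hrR : r ≤ R ^ (1 / θ)) : r ^ (-(1 - θ)) ≤ R / r := by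
  have h1 : r ^ θ ≤ R := by
    calc r ^ θ ≤ (R ^ (1 / θ)) ^ θ := by gcongr
      _ = R := by rw [← Real.rpow_mul hR.le, one_div_mul_cancel hθ.ne', Real.rpow_one]
  rw [neg_sub, Real.rpow_sub hr, Real.rpow_one]
  gcongr

theorem rpow_le_self_of_lt {θ R : ℝ} (hθ : θ ∈ Ioo (0 : ℝ) 1) (hR : 0 < R) (hR1 : R ≤ 1) :
    R ^ (1 / θ) ≤ R := by
  have h1 : 1 ≤ 1 / θ := (one_le_div hθ.1).2 hθ.2.le
  simpa using Real.rpow_le_rpow_of_exponent_ge hR hR1 h1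

/-- The alternative `hst` decides for each type `n` which estimate is used: dimension at most `s n`,
or few points. -/
theorem exists_coveredBy_spectrumSet (hc : 0 < c) (hcs : ∀ n, c ≤ s n)
    (hsd : ∀ n, s n ≤ d) {θ t : ℝ} (hθ : θ ∈ Ioo (0 : ℝ) 1) (hct : c ≤ t)
    (hst : ∀ n : ℕ, s n ≤ t ∨ 1 / (n + 1 : ℝ) ≤ 1 - θ) {ε : ℝ} (hε : 0 < ε) :
    ∃ C : ℝ, 0 < C ∧ ∀ R : ℝ, 0 < R → R ≤ 1 → ∀ r : ℝ, 0 < r → r ≤ R ^ (1 / θ) → ∀ x,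
      CoveredBy r (spectrumSet d c s ∩ Metric.ball x R) (C * (R / r) ^ (t + ε)) := by
  have hθ' : 0 < 1 - θ := by linarith [hθ.2]
  obtain ⟨C₁, hC₁, h₁⟩ := exists_coveredBy_spectrumBlock_inter_ball hc hcs hsd
  obtain ⟨C₂, hC₂, h₂⟩ := exists_coveredBy_spectrumBlock hc hcs hsd
  -- The loss is taken to be `r ^ (-(ε * (1 - θ)))`, which is at most `(R / r) ^ ε`.
  obtain ⟨C₃, hC₃, h₃⟩ := exists_coveredBy_spectrumSet_inter_ball hc hcs hsd
    (mul_pos hε hθ')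
  refine ⟨C₃ * (C₁ * C₂), by positivity, fun R hR hR1 r hr hrR x => ?_⟩
  have hrR' : r ≤ R := hrR.trans (rpow_le_self_of_lt hθ hR hR1)
  have hr1 : r ≤ 1 := hrR'.trans hR1
  have hq : 1 ≤ R / r := (one_le_div hr).2 hrR'
  have hq0 : 0 < R / r := by positivity
  have hrq := rpow_le_div_of_le_rpow hθ.1 hr hR hrR
  have ht : 0 ≤ t := hc.le.trans hct
  have hqt : 1 ≤ (R / r) ^ t := Real.one_le_rpow hq ht
  refine (h₃ r hr hr1 x R (C₁ * C₂ * (R / r) ^ t) ?_ ?_).mono subset_rfl ?_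
  · exact one_le_mul_of_one_le_of_one_le (one_le_mul_of_one_le_of_one_le hC₁ hC₂) hqt
  · intro k
    rcases hst (Nat.unpair k).1 with h | h
    · refine (h₁ k r R hr hrR' x).mono subset_rfl ?_
      calc C₁ * (R / r) ^ s (Nat.unpair k).1 ≤ C₁ * (R / r) ^ t := by gcongr
        _ ≤ C₁ * C₂ * (R / r) ^ t := by gcongr; exact le_mul_of_one_le_right (by linarith) hC₂
    · refine (h₂ k r hr hr1).mono inter_subset_left ?_
      have h4 : r ^ (-(c / ((Nat.unpair k).1 + 1 : ℝ))) ≤ (R / r) ^ t := by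
        calc r ^ (-(c / ((Nat.unpair k).1 + 1 : ℝ))) ≤ r ^ (-(1 - θ) * c) := by
              refine Real.rpow_le_rpow_of_exponent_ge hr hr1 ?_
              rw [neg_mul]
              refine neg_le_neg ?_
              rw [div_eq_mul_one_div, mul_comm]
              gcongr
          _ = (r ^ (-(1 - θ))) ^ c := Real.rpow_mul hr.le _ _
          _ ≤ (R / r) ^ c := by gcongr
          _ ≤ (R / r) ^ t := by gcongr
      calc C₂ * r ^ (-(c / ((Nat.unpair k).1 + 1 : ℝ))) ≤ C₂ * (R / r) ^ t := by gcongr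
        _ ≤ C₁ * C₂ * (R / r) ^ t := by gcongr; exact le_mul_of_one_le_left (by linarith) hC₁
  · have h5 : r ^ (-(ε * (1 - θ))) ≤ (R / r) ^ ε := by
      calc r ^ (-(ε * (1 - θ))) = (r ^ (-(1 - θ))) ^ ε := by
            rw [← Real.rpow_mul hr.le]
            ring_nf
        _ ≤ (R / r) ^ ε := by gcongr
    calc C₃ * r ^ (-(ε * (1 - θ))) * (C₁ * C₂ * (R / r) ^ t)
        ≤ C₃ * (R / r) ^ ε * (C₁ * C₂ * (R / r) ^ t) := by gcongr
      _ = _ := by rw [Real.rpow_add hq0]; ring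

theorem zero_mem_spectrumSet : (0 : EuclideanSpace ℝ (Fin d)) ∈ spectrumSet d c s :=
  Set.mem_iUnion.2 ⟨0, zero_mem_digitBlock _ _ _ _⟩

/-- The blocks are finite and shrink to `0`: an ultrafilter either contains a finite union of
blocks, which is compact, or avoids all of these and converges to `0`. -/
theorem isCompact_spectrumSet (hc : 0 < c) (hcs : ∀ n, c ≤ s n) (hsd : ∀ n, s n ≤ d) :
    IsCompact (spectrumSet d c s) := by
  have h0 : ∀ n, 0 < s n := fun n => hc.trans_le (hcs n)
  rw [isCompact_iff_ultrafilter_le_nhds]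
  intro f hf
  rw [le_principal_iff] at hf
  by_cases hex : ∃ L : ℕ, (⋃ k ∈ Finset.range L, spectrumBlock d c s k) ∈ f
  · obtain ⟨L, hL⟩ := hex
    have hfin : (⋃ k ∈ Finset.range L, spectrumBlock d c s k).Finite :=
      Set.Finite.biUnion (Finset.finite_toSet _) fun k _ => digitBlock_finite _ _ _ _
    obtain ⟨x, hx, hfx⟩ := isCompact_iff_ultrafilter_le_nhds.1 hfin.isCompact f
      (le_principal_iff.2 hL)
    exact ⟨x, Set.iUnion₂_subset (fun k _ => Set.subset_iUnion (spectrumBlock d c s) k) hx, hfx⟩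
  · refine ⟨0, zero_mem_spectrumSet, (Metric.nhds_basis_ball.ge_iff).2 fun r hr => ?_⟩
    push Not at hex
    have hA : (0 : ℝ) < 3 * (d + 1) := by positivity
    obtain ⟨L, hL⟩ := exists_pow_lt_of_lt_one (div_pos hr hA) (show (1 / 2 : ℝ) < 1 by norm_num)
    have hL' := Ultrafilter.compl_mem_iff_notMem.2 (hex L)
    filter_upwards [hf, hL'] with y hy hyL
    obtain ⟨k, hk⟩ := Set.mem_iUnion.1 hy
    have hLk : L ≤ k := by
      by_contra hlt
      exact hyL (Set.mem_biUnion (by simpa using hlt) hk)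
    refine digitBlock_subset_ball (blockScale_pos d c k) (blockRatio_pos d s k)
      (blockRatio_le h0 hsd k) k ?_ hk
    have h1 : blockScale d c k ≤ (1 / 2) ^ L :=
      (blockScale_le hc ((hcs 0).trans (hsd 0)) k).trans
        (pow_le_pow_of_le_one (by norm_num) (by norm_num) hLk)
    have h2 := h1.trans hL.le
    rwa [le_div_iff₀' hA] at h2

/-! ### Lower covering bound for the union. -/

theorem exists_le_coverNum_spectrumSet (hc : 0 < c) (hcs : ∀ n, c ≤ s n) (hsd : ∀ n, s n ≤ d)
    (n : ℕ) {θ : ℝ} (hθ : θ ∈ Ioo (0 : ℝ) 1) (hθn : 1 / θ ≤ 1 + c / (s n * (n + 1))) :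
    ∃ C : ℝ, 0 < C ∧ ∀ η > 0, ∃ R : ℝ, 0 < R ∧ R ≤ 1 ∧ R < η ∧
      ENNReal.ofReal (C * (R / R ^ (1 / θ)) ^ s n) ≤
        (coverNum (R ^ (1 / θ)) (spectrumSet d c s ∩ Metric.ball 0 R) : ℝ≥0∞) := by
  have h0 : ∀ n, 0 < s n := fun n => hc.trans_le (hcs n)
  have hd : (0 : ℝ) < d := (h0 0).trans_le (hsd 0)
  have hA : (1 : ℝ) ≤ 3 * (d + 1) := by linarith
  set A : ℝ := 3 * (d + 1)
  have hA0 : 0 < A := by linarith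
  have hb : 0 < 1 / θ - 1 := by
    have := (one_lt_div hθ.1).2 hθ.2
    linarith
  set ρ : ℝ := 2 ^ (-(d / s n)) with hρ
  have hρ0 : 0 < ρ := Real.rpow_pos_of_pos two_pos _
  refine ⟨(ρ / A) ^ s n, by positivity, fun η hη => ?_⟩
  have hlim : Tendsto (fun j => blockScale d c (Nat.pair n j)) atTop (𝓝 0) := by
    refine squeeze_zero (fun j => (blockScale_pos _ _ _).le) (fun j => ?_)
      (tendsto_pow_atTop_nhds_zero_of_lt_one (r := (1 / 2 : ℝ)) (by norm_num) (by norm_num))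
    exact (blockScale_le hc ((hcs 0).trans (hsd 0)) _).trans
      (pow_le_pow_of_le_one (by norm_num) (by norm_num) (Nat.right_le_pair n j))
  have hlim1 : Tendsto (fun j => A * blockScale d c (Nat.pair n j)) atTop (𝓝 0) := by
    simpa using hlim.const_mul A
  have hlim2 : Tendsto (fun j => A ^ (1 / θ) * blockScale d c (Nat.pair n j) ^ (1 / θ - 1))
      atTop (𝓝 0) := by
    have := (hlim.rpow_const (p := 1 / θ - 1) (Or.inr hb.le)).const_mul (A ^ (1 / θ))
    rwa [Real.zero_rpow hb.ne', mul_zero] at this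
  -- For large `j` the radius `R = A * δ` is below `min 1 η` and `R ^ (1 / θ) < δ`, so the smaller
  -- scale lies inside the block.
  obtain ⟨j, hj1, hj2⟩ := ((hlim1.eventually (gt_mem_nhds (lt_min one_pos hη))).and
    (hlim2.eventually (gt_mem_nhds one_pos))).exists
  set k := Nat.pair n j with hk
  have hkn : (Nat.unpair k).1 = n := by rw [hk, Nat.unpair_pair]
  set δ := blockScale d c k with hδ
  have hδ0 : 0 < δ := blockScale_pos d c k
  have hρk : blockRatio d s k = ρ := by rw [blockRatio, hkn]
  have hρ2 : ρ ≤ 1 / 2 := hρk ▸ blockRatio_le h0 hsd k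
  have hR0 : 0 < A * δ := by positivity
  have hR1 : A * δ ≤ 1 := (hj1.trans_le (min_le_left _ _)).le
  refine ⟨A * δ, hR0, hR1, hj1.trans_le (min_le_right _ _), ?_⟩
  set r := (A * δ) ^ (1 / θ) with hr
  have hr0 : 0 < r := by positivity
  have hrδ : r / δ = A ^ (1 / θ) * δ ^ (1 / θ - 1) := by
    rw [hr, Real.mul_rpow hA0.le hδ0.le, Real.rpow_sub hδ0, Real.rpow_one, mul_div_assoc]
  obtain ⟨l, hl1, hl2⟩ := exists_nat_pow_near_of_lt_one (x := r / δ) (y := ρ) (by positivity)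
    (by rw [hrδ]; exact hj2.le) hρ0 (by linarith)
  have hδ1 : δ ≤ 1 := (le_mul_of_one_le_left hδ0.le hA).trans hR1
  -- This is where `hθn` enters: `R ^ (1 / θ)` is not below the finest scale `δ * ρ ^ k` of the
  -- block.
  have hlk : l ≤ k := by
    by_contra! hlt
    have e1 : ρ ^ l < ρ ^ k := pow_lt_pow_right_of_lt_one₀ hρ0 (by linarith) hlt
    have e2 : ρ ^ k ≤ r / δ := by
      rw [← hρk, blockRatio_pow_eq hc h0, hkn, hrδ]
      calc δ ^ (c / (s n * (n + 1))) ≤ δ ^ (1 / θ - 1) :=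
            Real.rpow_le_rpow_of_exponent_ge hδ0 hδ1 (by linarith)
        _ ≤ A ^ (1 / θ) * δ ^ (1 / θ - 1) :=
            le_mul_of_one_le_left (by positivity) (Real.one_le_rpow hA (by linarith))
    linarith
  have hsub : spectrumBlock d c s k ⊆ spectrumSet d c s ∩ Metric.ball 0 (A * δ) :=
    Set.subset_inter (Set.subset_iUnion (spectrumBlock d c s) k)
      (digitBlock_subset_ball hδ0 (blockRatio_pos d s k) (blockRatio_le h0 hsd k) k le_rfl)
  have hcard := le_coverNum (r := r) (m := 2 ^ (d * l))
    (F := spectrumSet d c s ∩ Metric.ball 0 (A * δ)) fun t ht =>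
      two_pow_le_card_of_digitBlock_subset hδ0 (blockRatio_pos d s k) (blockRatio_le h0 hsd k) hlk
        (by rwa [hρk, ← div_le_iff₀' hδ0]) t (hsub.trans ht)
  refine (ENNReal.ofReal_le_ofReal ?_).trans hcard
  have hρl : 0 < ρ ^ l := pow_pos hρ0 l
  have h6 : ((2 : ℝ) ^ d) = ρ ^ (-s n) := by
    rw [hρ, ← Real.rpow_mul two_pos.le, ← Real.rpow_natCast]
    congr 1
    have := (h0 n).ne'
    field_simp
  calc (ρ / A) ^ s n * (A * δ / r) ^ s n = (ρ * (δ / r)) ^ s n := by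
        rw [← Real.mul_rpow (by positivity) (by positivity)]
        congr 1
        field_simp
    _ ≤ (1 / ρ ^ l) ^ s n := by
        have := h0 n
        gcongr
        rw [div_eq_mul_one_div, mul_left_comm]
        have h7 : ρ * ρ ^ l * δ ≤ r := by
          rw [lt_div_iff₀ hδ0, pow_succ'] at hl1
          exact hl1.le
        rw [← mul_assoc, mul_one_div, div_le_div_iff₀ hr0 hρl]
        linarith
    _ = ((2 ^ (d * l) : ℕ) : ℝ) := by
        push_cast
        rw [pow_mul, h6, one_div, ← inv_pow, ← Real.rpow_natCast, ← Real.rpow_natCast,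
          ← Real.rpow_mul (by positivity), ← Real.rpow_mul hρ0.le, Real.inv_rpow hρ0.le,
          ← Real.rpow_neg hρ0.le]
        congr 1
        ring

end

/-! ### From covering bounds to the spectra. -/

section
variable {E : Type*} [NormedAddCommGroup E]

/-- As `R → 0` the ratio `R / R ^ (1 / θ)` tends to infinity, so its powers can be compared only if
`s ≤ α`. -/
theorem le_of_forall_coverNum_le {F : Set E} {θ α C c s : ℝ} (hθ : θ ∈ Ioo (0 : ℝ) 1)
    (hC : 0 < C) (hc : 0 < c) {x : E} (hx : x ∈ F)
    (hα : ∀ δ : ℝ, 0 < δ → δ ≤ 1 → ∀ x ∈ F,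
      (coverNum (δ ^ (1 / θ)) (F ∩ Metric.ball x δ) : ℝ≥0∞) ≤
        ENNReal.ofReal (C * (δ / δ ^ (1 / θ)) ^ α))
    (hs : ∀ η > 0, ∃ R : ℝ, 0 < R ∧ R ≤ 1 ∧ R < η ∧
      ENNReal.ofReal (c * (R / R ^ (1 / θ)) ^ s) ≤
        (coverNum (R ^ (1 / θ)) (F ∩ Metric.ball x R) : ℝ≥0∞)) : s ≤ α := by
  by_contra! hlt
  have hb : 0 < 1 / θ - 1 := by
    have := (one_lt_div hθ.1).2 hθ.2
    linarith
  have hneg : -((1 / θ - 1) * (s - α)) < 0 := neg_neg_of_pos (mul_pos hb (by linarith))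
  have hlim := (tendsto_rpow_neg_nhdsGT_zero hneg).eventually (eventually_gt_atTop (C / c))
  obtain ⟨η, hη, hηC⟩ := mem_nhdsGT_iff_exists_Ioo_subset.1 hlim
  obtain ⟨R, hR0, hR1, hRη, hR⟩ := hs η hη
  have h1 := hR.trans (hα R hR0 hR1 x hx)
  have hq : 0 < R / R ^ (1 / θ) := by positivity
  rw [ENNReal.ofReal_le_ofReal_iff (by positivity)] at h1
  have h2 : C / c < R ^ (-((1 / θ - 1) * (s - α))) := hηC ⟨hR0, hRη⟩
  have h3 : R ^ (-((1 / θ - 1) * (s - α))) = (R / R ^ (1 / θ)) ^ (s - α) := by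
    rw [← Real.rpow_one_sub' hR0.le (by linarith), ← Real.rpow_mul hR0.le]
    ring_nf
  rw [h3, Real.rpow_sub hq, div_lt_div_iff₀ hc (by positivity)] at h2
  linarith

/-- The case `s = 0`: a nonempty set needs at least one ball. It supplies the lower bounds that
`sInf` on the reals requires. -/
theorem nonneg_of_forall_coverNum_le {F : Set E} {θ α C : ℝ} (hθ : θ ∈ Ioo (0 : ℝ) 1)
    (hC : 0 < C) {x : E} (hx : x ∈ F)
    (hα : ∀ δ : ℝ, 0 < δ → δ ≤ 1 → ∀ x ∈ F,
      (coverNum (δ ^ (1 / θ)) (F ∩ Metric.ball x δ) : ℝ≥0∞) ≤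
        ENNReal.ofReal (C * (δ / δ ^ (1 / θ)) ^ α)) : 0 ≤ α := by
  refine le_of_forall_coverNum_le hθ hC one_pos hx hα fun η hη => ?_
  obtain ⟨R, hR0, hR⟩ := exists_between (lt_min one_pos hη)
  refine ⟨R, hR0, (hR.trans_le (min_le_left _ _)).le, hR.trans_le (min_le_right _ _), ?_⟩
  have := le_coverNum (r := R ^ (1 / θ)) (m := 1) (F := F ∩ Metric.ball x R) fun t ht => by
    rw [Nat.one_le_iff_ne_zero, Finset.card_ne_zero]
    have hxt := ht ⟨hx, Metric.mem_ball_self hR0⟩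
    obtain ⟨y, hy, -⟩ := Set.mem_iUnion₂.1 hxt
    exact ⟨y, hy⟩
  simpa using this

end

section
variable {d : ℕ} {c : ℝ} {s : ℕ → ℝ}

theorem assouadSpectrum_le_upperAssouadSpectrum (hc : 0 < c) (hcs : ∀ n, c ≤ s n)
    (hsd : ∀ n, s n ≤ d) {θ : ℝ} (hθ : θ ∈ Ioo (0 : ℝ) 1) :
    assouadSpectrum θ (spectrumSet d c s) ≤ upperAssouadSpectrum θ (spectrumSet d c s) := by
  refine csInf_le_csInf ⟨0, ?_⟩ ?_ ?_
  · rintro α ⟨C, hC, h⟩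
    exact nonneg_of_forall_coverNum_le hθ hC zero_mem_spectrumSet h
  · obtain ⟨C, hC, h⟩ := exists_coveredBy_spectrumSet hc hcs hsd hθ
      ((hcs 0).trans (hsd 0)) (fun n => Or.inl (hsd n)) one_pos
    exact ⟨_, C, hC, fun R hR hR1 r hr hrR x _ => (h R hR hR1 r hr hrR x).coverNum_le⟩
  · rintro α ⟨C, hC, h⟩
    exact ⟨C, hC, fun R hR hR1 x hx => h R hR hR1 _ (by positivity) le_rfl x hx⟩

theorem upperAssouadSpectrum_spectrumSet_le (hc : 0 < c) (hcs : ∀ n, c ≤ s n)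
    (hsd : ∀ n, s n ≤ d) {θ t : ℝ} (hθ : θ ∈ Ioo (0 : ℝ) 1) (hct : c ≤ t)
    (hst : ∀ n : ℕ, s n ≤ t ∨ 1 / (n + 1 : ℝ) ≤ 1 - θ) :
    upperAssouadSpectrum θ (spectrumSet d c s) ≤ t := by
  refine le_of_forall_pos_le_add fun ε hε => csInf_le ⟨0, ?_⟩ ?_
  · rintro α ⟨C, hC, h⟩
    exact nonneg_of_forall_coverNum_le hθ hC zero_mem_spectrumSet
      fun R hR hR1 x hx => h R hR hR1 _ (by positivity) le_rfl x hx
  · obtain ⟨C, hC, h⟩ := exists_coveredBy_spectrumSet hc hcs hsd hθ hct hst hε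
    exact ⟨C, hC, fun R hR hR1 r hr hrR x _ => (h R hR hR1 r hr hrR x).coverNum_le⟩

theorem le_assouadSpectrum_spectrumSet (hc : 0 < c) (hcs : ∀ n, c ≤ s n)
    (hsd : ∀ n, s n ≤ d) (n : ℕ) {θ : ℝ} (hθ : θ ∈ Ioo (0 : ℝ) 1)
    (hθn : 1 / θ ≤ 1 + c / (s n * (n + 1))) :
    s n ≤ assouadSpectrum θ (spectrumSet d c s) := by
  refine le_csInf ?_ ?_
  · obtain ⟨C, hC, h⟩ := exists_coveredBy_spectrumSet hc hcs hsd hθ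
      ((hcs 0).trans (hsd 0)) (fun n => Or.inl (hsd n)) one_pos
    exact ⟨_, C, hC, fun R hR hR1 x _ => (h R hR hR1 _ (by positivity) le_rfl x).coverNum_le⟩
  · rintro α ⟨C, hC, h⟩
    obtain ⟨C', hC', h'⟩ := exists_le_coverNum_spectrumSet hc hcs hsd n hθ hθn
    exact le_of_forall_coverNum_le hθ hC hC' zero_mem_spectrumSet h h'

end

theorem exists_isCompact_assouadSpectrum_le (d : ℕ) (f : ℝ → ℝ)
    (hmaps : MapsTo f (Icc 0 1) (Icc 0 (d : ℝ))) (hmono : MonotoneOn f (Icc 0 1))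
    (hpos : 0 < f 0) (hlim : Tendsto f (𝓝[<] 1) (𝓝 (f 1))) :
    ∃ F : Set (EuclideanSpace ℝ (Fin d)), IsCompact F ∧
      (∀ θ ∈ Ioo (0 : ℝ) 1, assouadSpectrum θ F ≤ f θ) ∧
      Tendsto (fun θ : ℝ => assouadSpectrum θ F) (𝓝[<] 1) (𝓝 (f 1)) ∧
      quasiAssouadDim F = f 1 := by
  have hφ : ∀ n : ℕ, (1 - 1 / (n + 1 : ℝ)) ∈ Icc (0 : ℝ) 1 := fun n => by
    have h1 : (0 : ℝ) < 1 / (n + 1) := Nat.one_div_pos_of_nat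
    have h2 : 1 / (n + 1 : ℝ) ≤ 1 := by
      rw [div_le_one (by positivity)]
      linarith [n.cast_nonneg (α := ℝ)]
    constructor <;> linarith
  have h01 : (0 : ℝ) ∈ Icc (0 : ℝ) 1 := by simp
  have h11 : (1 : ℝ) ∈ Icc (0 : ℝ) 1 := by simp
  set c := f 0
  -- With these sample points, `s n > f θ` forces `1 / (n + 1) ≤ 1 - θ`, the case in which the block
  -- is sparse.
  set s : ℕ → ℝ := fun n => f (1 - 1 / (n + 1 : ℝ)) with hs
  have hcs : ∀ n, c ≤ s n := fun n => hmono h01 (hφ n) (hφ n).1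
  have hsd : ∀ n, s n ≤ d := fun n => (hmaps (hφ n)).2
  have hup : ∀ θ ∈ Ioo (0 : ℝ) 1, upperAssouadSpectrum θ (spectrumSet d c s) ≤ f θ := by
    intro θ hθ
    have hθ' := Ioo_subset_Icc_self hθ
    refine upperAssouadSpectrum_spectrumSet_le hpos hcs hsd hθ (hmono h01 hθ' hθ'.1) fun n => ?_
    rcases le_total (1 - 1 / (n + 1 : ℝ)) θ with h | h
    · exact Or.inl (hmono (hφ n) hθ' h)
    · exact Or.inr (by linarith)
  have hle := fun θ (hθ : θ ∈ Ioo (0 : ℝ) 1) =>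
    assouadSpectrum_le_upperAssouadSpectrum hpos hcs hsd hθ
  have hev : ∀ᶠ θ : ℝ in 𝓝[<] 1, θ ∈ Ioo (0 : ℝ) 1 := Ioo_mem_nhdsLT one_pos
  have hslim : Tendsto s atTop (𝓝 (f 1)) := by
    refine hlim.comp (tendsto_nhdsWithin_iff.2 ⟨?_, .of_forall fun n => ?_⟩)
    · simpa using (tendsto_one_div_add_atTop_nhds_zero_nat (𝕜 := ℝ)).const_sub 1
    · have h1 : (0 : ℝ) < 1 / (n + 1) := Nat.one_div_pos_of_nat
      exact sub_lt_self 1 h1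
  have hlow : ∀ a < f 1, ∀ᶠ θ in 𝓝[<] 1, a < assouadSpectrum θ (spectrumSet d c s) := by
    intro a ha
    obtain ⟨n, hn⟩ := (hslim.eventually (lt_mem_nhds ha)).exists
    have hb : 0 < c / (s n * (n + 1)) := by
      have := hpos.trans_le (hcs n)
      positivity
    have hinv : Tendsto (fun θ : ℝ => 1 / θ) (𝓝[<] 1) (𝓝 1) := by
      have : ContinuousAt (fun θ : ℝ => 1 / θ) 1 :=
        continuousAt_const.div continuousAt_id one_ne_zero
      simpa using this.tendsto.mono_left nhdsWithin_le_nhds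
    filter_upwards [hev, hinv.eventually (gt_mem_nhds (lt_add_of_pos_right 1 hb))] with θ hθ hθn
    exact hn.trans_le (le_assouadSpectrum_spectrumSet hpos hcs hsd n hθ hθn.le)
  have hf1 : ∀ θ ∈ Ioo (0 : ℝ) 1, f θ ≤ f 1 := fun θ hθ =>
    hmono (Ioo_subset_Icc_self hθ) h11 hθ.2.le
  refine ⟨spectrumSet d c s, isCompact_spectrumSet hpos hcs hsd,
    fun θ hθ => (hle θ hθ).trans (hup θ hθ), ?_, Tendsto.limUnder_eq ?_⟩
  · refine tendsto_order.2 ⟨hlow, fun a ha => ?_⟩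
    filter_upwards [hev] with θ hθ
    exact (((hle θ hθ).trans (hup θ hθ)).trans (hf1 θ hθ)).trans_lt ha
  · refine tendsto_order.2 ⟨fun a ha => ?_, fun a ha => ?_⟩
    · filter_upwards [hev, hlow a ha] with θ hθ h
      exact h.trans_le (hle θ hθ)
    · filter_upwards [hev] with θ hθ
      exact ((hup θ hθ).trans (hf1 θ hθ)).trans_lt ha

/-! ### Isometry invariance, to pass from `EuclideanSpace ℝ (Fin 1)` to `ℝ`. -/

section
variable {E E' : Type*}

theorem coverNum_image_le [PseudoMetricSpace E] [PseudoMetricSpace E'] (e : E ≃ᵢ E') (δ : ℝ)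
    (S : Set E) : coverNum δ (e '' S) ≤ coverNum δ S := by
  classical
  refine le_iInf₂ fun t ht => (iInf₂_le (t.image e) ?_).trans
    (by exact_mod_cast Finset.card_image_le)
  rintro _ ⟨x, hx, rfl⟩
  obtain ⟨y, hy, hxy⟩ := Set.mem_iUnion₂.1 (ht hx)
  refine Set.mem_biUnion (x := e y) (Finset.mem_image_of_mem _ hy) ?_
  rwa [Metric.mem_ball, e.dist_eq]

theorem coverNum_image [PseudoMetricSpace E] [PseudoMetricSpace E'] (e : E ≃ᵢ E') (δ : ℝ)
    (S : Set E) : coverNum δ (e '' S) = coverNum δ S := by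
  refine le_antisymm (coverNum_image_le e δ S) ?_
  have := coverNum_image_le e.symm δ (e '' S)
  rwa [← Set.image_comp, e.symm_comp_self, Set.image_id] at this

theorem assouadSpectrum_image [NormedAddCommGroup E] [NormedSpace ℝ E] [FiniteDimensional ℝ E]
    [NormedAddCommGroup E'] [NormedSpace ℝ E'] [FiniteDimensional ℝ E'] (e : E ≃ᵢ E') (θ : ℝ)
    (F : Set E) : assouadSpectrum θ (e '' F) = assouadSpectrum θ F := by
  have h : ∀ x δ, e '' F ∩ Metric.ball (e x) δ = e '' (F ∩ Metric.ball x δ) := fun x δ => by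
    rw [Set.image_inter e.injective, e.image_ball]
  unfold assouadSpectrum
  simp only [Set.forall_mem_image, h, coverNum_image]

end

/-! ### A logarithmic rate excludes Hölder continuity. -/

/-- The value at 1 is set separately because `Real.log 0 = 0` would give `1 / 2` there. The constant
2 gives the positive value `1 / 2` at 0. -/
theorem monotoneOn_one_sub_inv_log :
    MonotoneOn (fun θ : ℝ => if θ < 1 then 1 - (2 - Real.log (1 - θ))⁻¹ else 1) (Icc 0 1) := by
  intro x hx y hy hxy
  have hlog : ∀ z ∈ Icc (0 : ℝ) 1, Real.log (1 - z) ≤ 0 := fun z hz =>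
    Real.log_nonpos (by linarith [hz.2]) (by linarith [hz.1])
  have h1 := hlog x hx
  have h2 := hlog y hy
  by_cases hy1 : y < 1
  · have h3 : Real.log (1 - y) ≤ Real.log (1 - x) := Real.log_le_log (by linarith) (by linarith)
    simp only [hy1, hxy.trans_lt hy1, if_true]
    gcongr
    linarith
  · simp only [hy1, if_false]
    split_ifs
    · have : 0 ≤ (2 - Real.log (1 - x))⁻¹ := inv_nonneg.2 (by linarith)
      linarith
    · exact le_rfl

theorem tendsto_one_sub_nhdsLT_one :
    Tendsto (fun θ : ℝ => 1 - θ) (𝓝[<] 1) (𝓝[>] 0) := by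
  refine tendsto_nhdsWithin_iff.2 ⟨?_, ?_⟩
  · have : Tendsto (fun θ : ℝ => 1 - θ) (𝓝 1) (𝓝 (1 - 1)) := tendsto_id.const_sub 1
    rw [sub_self] at this
    exact this.mono_left nhdsWithin_le_nhds
  · filter_upwards [self_mem_nhdsWithin] with θ hθ
    exact sub_pos.2 (mem_Iio.1 hθ)

theorem tendsto_one_sub_inv_log :
    Tendsto (fun θ : ℝ => if θ < 1 then 1 - (2 - Real.log (1 - θ))⁻¹ else 1) (𝓝[<] 1) (𝓝 1) := by
  have h1 : Tendsto (fun θ : ℝ => 2 - Real.log (1 - θ)) (𝓝[<] 1) atTop := by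
    simp only [sub_eq_add_neg (2 : ℝ)]
    exact tendsto_atTop_add_const_left _ _
      (tendsto_neg_atBot_atTop.comp (Real.tendsto_log_nhdsGT_zero.comp tendsto_one_sub_nhdsLT_one))
  have h2 : Tendsto (fun θ : ℝ => 1 - (2 - Real.log (1 - θ))⁻¹) (𝓝[<] 1) (𝓝 1) := by
    simpa using (tendsto_inv_atTop_zero.comp h1).const_sub 1
  refine h2.congr' ?_
  filter_upwards [self_mem_nhdsWithin] with θ hθ
  exact (if_pos hθ).symm

theorem not_holderOnWith_of_le_one_sub_inv_log {g : ℝ → ℝ}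
    (hg : ∀ θ ∈ Ioo (0 : ℝ) 1, g θ ≤ 1 - (2 - Real.log (1 - θ))⁻¹)
    (hlim : Tendsto g (𝓝[<] 1) (𝓝 1)) {U : Set ℝ} (hU : U ∈ 𝓝 (1 : ℝ)) (C r : ℝ≥0) (hr : 0 < r) :
    ¬ HolderOnWith C r g (U ∩ Ioo 0 1) := by
  intro hH
  have hev : ∀ᶠ θ : ℝ in 𝓝[<] 1, θ ∈ U ∩ Ioo 0 1 :=
    inter_mem (mem_nhdsWithin_of_mem_nhds hU) (Ioo_mem_nhdsLT one_pos)
  have hr' : (0 : ℝ) < r := hr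
  -- Letting `θ' → 1` in the Hölder inequality bounds the gap `1 - g θ`.
  have h1 : ∀ θ ∈ U ∩ Ioo 0 1, (2 - Real.log (1 - θ))⁻¹ ≤ C * (1 - θ) ^ (r : ℝ) := by
    intro θ hθ
    have hdist : dist (g θ) 1 ≤ C * dist θ 1 ^ (r : ℝ) := by
      have l1 : Tendsto (fun θ' => dist (g θ) (g θ')) (𝓝[<] 1) (𝓝 (dist (g θ) 1)) :=
        tendsto_const_nhds.dist hlim
      have l2 : Tendsto (fun θ' => C * dist θ θ' ^ (r : ℝ)) (𝓝[<] 1)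
          (𝓝 (C * dist θ 1 ^ (r : ℝ))) := by
        refine Tendsto.const_mul _ (Tendsto.rpow_const ?_ (Or.inr hr'.le))
        exact tendsto_const_nhds.dist (tendsto_id.mono_left nhdsWithin_le_nhds)
      refine le_of_tendsto_of_tendsto l1 l2 ?_
      filter_upwards [hev] with θ' hθ'
      exact hH.dist_le hθ hθ'
    rw [Real.dist_eq, Real.dist_eq, abs_sub_comm, abs_sub_comm θ,
      abs_of_pos (sub_pos.2 hθ.2.2)] at hdist
    have := hg θ hθ.2
    linarith [le_abs_self (1 - g θ)]
  -- With `y = 1 - θ`, `h1` says that this expression is at least 1, yet powers beat logarithms as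
  -- `y → 0`.
  have h2 : Tendsto (fun y : ℝ => C * (2 * y ^ (r : ℝ) - Real.log y * y ^ (r : ℝ))) (𝓝[>] 0)
      (𝓝 0) := by
    have a1 : Tendsto (fun y : ℝ => y ^ (r : ℝ)) (𝓝[>] 0) (𝓝 0) := by
      have := (Real.continuousAt_rpow_const (0 : ℝ) r (Or.inr hr'.le)).tendsto
      rw [Real.zero_rpow hr'.ne'] at this
      exact this.mono_left nhdsWithin_le_nhds
    have := ((a1.const_mul 2).sub (tendsto_log_mul_rpow_nhdsGT_zero hr')).const_mul (C : ℝ)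
    simpa using this
  have h3 := (h2.comp tendsto_one_sub_nhdsLT_one).eventually (gt_mem_nhds one_pos)
  obtain ⟨θ, hθ, hθ3⟩ := (hev.and h3).exists
  have h4 : Real.log (1 - θ) ≤ 0 :=
    Real.log_nonpos (by linarith [hθ.2.2]) (by linarith [hθ.2.1])
  have h5 := h1 θ hθ
  rw [inv_le_iff_one_le_mul₀ (by linarith)] at h5
  simp only [Function.comp_apply] at hθ3
  linarith

theorem exists_isCompact_not_holderOnWith : ∃ F : Set ℝ, IsCompact F ∧
    ∀ U ∈ 𝓝 (1 : ℝ), ∀ C r : ℝ≥0, 0 < r →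
      ¬ HolderOnWith C r (fun θ : ℝ => assouadSpectrum θ F) (U ∩ Ioo 0 1) := by
  set f : ℝ → ℝ := fun θ => if θ < 1 then 1 - (2 - Real.log (1 - θ))⁻¹ else 1 with hf
  have hmono : MonotoneOn f (Icc 0 1) := monotoneOn_one_sub_inv_log
  have h0 : f 0 = 1 / 2 := by norm_num [hf]
  have h1 : f 1 = 1 := by simp [hf]
  have hmaps : MapsTo f (Icc 0 1) (Icc 0 ((1 : ℕ) : ℝ)) := fun x hx => by
    have a := hmono (by simp) hx hx.1
    have b := hmono hx (by simp) hx.2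
    rw [h0] at a
    rw [h1] at b
    rw [Nat.cast_one]
    constructor <;> linarith
  obtain ⟨F, hF, hle, hlim, -⟩ := exists_isCompact_assouadSpectrum_le 1 f hmaps hmono
    (by rw [h0]; norm_num) (by rw [h1]; exact tendsto_one_sub_inv_log)
  let e : EuclideanSpace ℝ (Fin 1) ≃ᵢ ℝ :=
    (OrthonormalBasis.singleton (Fin 1) ℝ).repr.symm.toIsometryEquiv
  refine ⟨e '' F, hF.image e.continuous, fun U hU C r hr => ?_⟩
  simp only [assouadSpectrum_image]
  rw [h1] at hlim
  refine not_holderOnWith_of_le_one_sub_inv_log (fun θ hθ => ?_) hlim hU C r hr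
  simpa only [hf, if_pos hθ.2] using hle θ hθ

theorem theoremB :
    (∃ F : Set ℝ, IsCompact F ∧
      ∀ U ∈ 𝓝 (1 : ℝ), ∀ C r : ℝ≥0, 0 < r →
        ¬ HolderOnWith C r (fun θ : ℝ => assouadSpectrum θ F) (U ∩ Ioo 0 1)) ∧
    (∀ (d : ℕ) (f : ℝ → ℝ), MapsTo f (Icc 0 1) (Icc 0 (d : ℝ)) → MonotoneOn f (Icc 0 1) →
      0 < f 0 → Tendsto f (𝓝[<] 1) (𝓝 (f 1)) →
      ∃ F : Set (EuclideanSpace ℝ (Fin d)), IsCompact F ∧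
        (∀ θ ∈ Ioo (0 : ℝ) 1, assouadSpectrum θ F ≤ f θ) ∧
        Tendsto (fun θ : ℝ => assouadSpectrum θ F) (𝓝[<] 1) (𝓝 (f 1)) ∧
        quasiAssouadDim F = f 1) :=
  ⟨exists_isCompact_not_holderOnWith, exists_isCompact_assouadSpectrum_le⟩
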